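/- Let $\mathbb{Q}\mathbb{U}$ be the rational Urysohn space, i.e. the (unique up to isometry) countable metric space with rational distances such that for every finite $A\subseteq\mathbb{Q}\mathbb{U}$ and every $g:A\to\mathbb{Q}_{\ge 0}$ with $|g(a)-g(b)|\le d(a,b)\le g(a)+g(b)$ for all $a,b\in A$ there is a point $z\in\mathbb{Q}\mathbb{U}$ with $d(z,a)=g(a)$ for all $a\in A$. Let $\mathbb{U}$ be the Urysohn space, i.e. the (unique up to isometry) complete separable metric space that is homogeneous (every isometry between finite subsets extends to an isometry of $\mathbb{U}$ onto itself) and universal (every complete separable metric space embeds isometrically in $\mathbb{U}$). Write $\mathrm{Aut}(M)$ for the group of isometries of a metric space $M$ onto itself. Call $g\in\mathrm{Aut}(\mathbb{Q}\mathbb{U})$ cyclic if it permutes all points of $\mathbb{Q}\mathbb{U}$ in a single cycle, i.e. for all $x,y$ there is $n\in\mathbb{Z}$ with $g^n x=y$. (1) The cyclic isometries form exactly $2^{\aleph_0}$ conjugacy classes of $\mathrm{Aut}(\mathbb{Q}\mathbb{U})$. (2) For cyclic $g$ the Toeplitz function $f_g(n)=d(x,g^n x)$, $n\ge 0$, does not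 depend on the point $x\in\mathbb{Q}\mathbb{U}$, and two cyclic isometries $g,h$ are conjugate in $\mathrm{Aut}(\mathbb{Q}\mathbb{U})$ if and only if $f_g=f_h$. (3) $\mathbb{Q}\mathbb{U}$ embeds isometrically in $\mathbb{U}$ as a dense subset. For every such embedding, extension of isometries from $\mathbb{Q}\mathbb{U}$ to $\mathbb{U}$ is an injective group homomorphism $\mathrm{Aut}(\mathbb{Q}\mathbb{U})\to\mathrm{Aut}(\mathbb{U})$, $g\mapsto\hat g$; and if $g,h$ are cyclic isometries that are not conjugate in $\mathrm{Aut}(\mathbb{Q}\mathbb{U})$, then $\hat g,\hat h$ are not conjugate in $\mathrm{Aut}(\mathbb{U})$. -/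

import Mathlib

universe u v

/-- `Q` is (a copy of) the rational Urysohn space: a countable metric space with rational distances
such that every one-point rational extension of a finite subset `A` is realised in `Q`. -/
structure IsRationalUrysohn (Q : Type u) [MetricSpace Q] : Prop where
  countable : Countable Q
  rational : ∀ x y : Q, ∃ q : ℚ, dist x y = (q : ℝ)
  extension : ∀ (A : Finset Q) (g : Q → ℚ),
    (∀ a ∈ A, 0 ≤ g a) →
    (∀ a ∈ A, ∀ b ∈ A, |(g a : ℝ) - (g b : ℝ)| ≤ dist a b ∧ dist a b ≤ (g a : ℝ) + (g b : ℝ)) →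
    ∃ z : Q, ∀ a ∈ A, dist z a = (g a : ℝ)

/-- `U` is (a copy of) the Urysohn space: a complete separable metric space that is homogeneous
(isometries between finite subsets extend to isometries of `U` onto itself) and universal
(every complete separable metric space embeds isometrically into it). A separable metric space has
at most continuum many points, so letting `X` range over `Type` is no restriction. -/
structure IsUrysohn (U : Type v) [MetricSpace U] : Prop where
  complete : CompleteSpace U
  separable : TopologicalSpace.SeparableSpace U
  homogeneous : ∀ (A : Finset U) (f : A → U), Isometry f →
    ∃ g : U ≃ᵢ U, ∀ a : A, g (a : U) = f a
  universal : ∀ (X : Type) [MetricSpace X] [CompleteSpace X] [TopologicalSpace.SeparableSpace X],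
    ∃ f : X → U, Isometry f

/-- The isometry `g` permutes all the points of `X` in a single cycle (possibly infinite): any two
points differ by an integer power of `g`. -/
def IsCyclicIsometry {X : Type u} [MetricSpace X] (g : X ≃ᵢ X) : Prop :=
  Equiv.Perm.IsCycleOn g.toEquiv (Set.univ : Set X)

/-- The Toeplitz function `n ↦ d(x, gⁿ x)` of the isometry `g`, based at the point `x`. -/
def toeplitz {X : Type u} [MetricSpace X] (g : X ≃ᵢ X) (x : X) (n : ℕ) : ℝ :=
  dist x ((g ^ n) x)

/-- The set of conjugacy classes of `Aut(X)`, the group of isometries of `X` onto itself, that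
consist of isometries permuting the points of `X` in a single cycle. -/
def cyclicClasses (X : Type u) [MetricSpace X] : Set (ConjClasses (X ≃ᵢ X)) :=
  {c | ∃ g : X ≃ᵢ X, IsCyclicIsometry g ∧ ConjClasses.mk g = c}

/-!
Two cyclic isometries `g`, `h` with the same Toeplitz function are conjugate by `gⁿ x ↦ hⁿ x`, and
a conjugacy preserves Toeplitz functions; hence the Toeplitz function is a complete invariant
(`isConj_iff_toeplitz_eq`), and there are at most continuum many classes. The extension of a cyclic
isometry to the Urysohn space `U` has the same Toeplitz function at every point, by density
(`toeplitz_eq_of_denseRange`), so conjugate extensions come from conjugate isometries.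

`U` has the finite extension property for real Katětov functions
(`IsUrysohn.hasFiniteExtension`), so that back and forth (`exists_isometry_range_meets`) embeds the
rational Urysohn space `Q` into `U`. The image can be made dense because the distances from a point
of `U` to a finite part of the image can be rounded up to rational ones
(`exists_dist_lt_of_isPartialIsometry`).

For continuum many classes one needs continuum many rational norms `f` on the group `ℤ` for which
the metric `f (m - n)` makes `ℤ` a rational Urysohn space: the translation by `1` is then cyclic
with Toeplitz function `f`, and is transported to `Q` by the uniqueness of `Q`. Such norms are limits
of norms with linear growth. Given such a norm and a Katětov function `g` on a finite set `A`, a new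
generator of length `g a` is adjoined at each `z - a`, for a distant `z`. Linear growth ensures that
paths using unequally many forward and backward jumps of size about `z` do not shorten anything that
has to be kept, and the Katětov inequalities take care of the others
(`IsTameNorm.exists_prescribed`). There is freedom at each stage, since the norm of a distant integer
may be chosen to be `1` or `2`, and so the construction runs along the branches of a binary tree
(`exists_injective_isUrysohnNorm`).
-/

/-! ### Finite extension properties -/

/-- Every one-point extension of a finite subset of `X`, given by a Katětov function `r` whose
values on the subset lie in `V`, is realised in `X`. Nonnegativity of `r` on `A` is automatic:
`0 = dist a a ≤ r a + r a`. -/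
def HasFiniteExtension (X : Type*) [MetricSpace X] (V : Set ℝ) : Prop :=
  ∀ (A : Finset X) (r : X → ℝ), (∀ a ∈ A, r a ∈ V) →
    (∀ a ∈ A, ∀ b ∈ A, |r a - r b| ≤ dist a b ∧ dist a b ≤ r a + r b) →
    ∃ z : X, ∀ a ∈ A, dist z a = r a

theorem IsRationalUrysohn.hasFiniteExtension {Q : Type*} [MetricSpace Q]
    (hQ : IsRationalUrysohn Q) : HasFiniteExtension Q (Set.range ((↑) : ℚ → ℝ)) := by
  classical
  intro A r hr hK
  have hr' : ∀ a, ∃ q : ℚ, a ∈ A → (q : ℝ) = r a := fun a ↦ by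
    by_cases ha : a ∈ A
    · obtain ⟨q, hq⟩ := hr a ha
      exact ⟨q, fun _ ↦ hq⟩
    · exact ⟨0, fun h ↦ absurd h ha⟩
  choose g hg using hr'
  obtain ⟨z, hz⟩ := hQ.extension A g
    (fun a ha ↦ by
      have h := (hK a ha a ha).2
      rw [dist_self, ← hg a ha] at h
      exact_mod_cast (by linarith : (0 : ℝ) ≤ g a))
    (fun a ha b hb ↦ by rw [hg a ha, hg b hb]; exact hK a ha b hb)
  exact ⟨z, fun a ha ↦ (hz a ha).trans (hg a ha)⟩

/-- The one-point extension of `A` is found in `ℝ ^ |A|` with the sup norm: send `a` to the vector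
of its distances to the points of `A` and the new point to the vector of the prescribed distances.
This copy of `A` lies in `U` by universality, and is moved onto `A` by homogeneity. -/
theorem IsUrysohn.hasFiniteExtension {U : Type*} [MetricSpace U] (hU : IsUrysohn U) :
    HasFiniteExtension U Set.univ := by
  intro A r _ hK
  let e := A.equivFin
  obtain ⟨F, hF⟩ := hU.universal (Fin A.card → ℝ)
  let κ : A → Fin A.card → ℝ := fun a i ↦ dist (a : U) (e.symm i)
  let ρ : Fin A.card → ℝ := fun i ↦ r (e.symm i)
  have hκ : Isometry κ := Isometry.of_dist_eq fun a b ↦ by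
    refine le_antisymm ((dist_pi_le_iff dist_nonneg).2 fun i ↦ ?_) ?_
    · rw [Real.dist_eq]
      exact abs_dist_sub_le _ _ _
    · have h := dist_le_pi_dist (κ a) (κ b) (e b)
      simp only [κ, Equiv.symm_apply_apply, dist_self, Real.dist_eq, sub_zero,
        abs_of_nonneg dist_nonneg] at h
      exact h
  have hρ : ∀ a : A, dist ρ (κ a) = r a := fun a ↦ by
    have h0 : 0 ≤ r a := by
      have h := (hK a a.2 a a.2).2
      rw [dist_self] at h
      linarith
    refine le_antisymm ((dist_pi_le_iff h0).2 fun i ↦ ?_) ?_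
    · obtain ⟨h1, h2⟩ := hK a a.2 (e.symm i) (e.symm i).2
      rw [abs_le] at h1
      rw [Real.dist_eq, abs_le]
      constructor <;> simp only [ρ, κ] <;> linarith
    · have h := dist_le_pi_dist ρ (κ a) (e a)
      simp only [κ, ρ, Equiv.symm_apply_apply, dist_self, Real.dist_eq, sub_zero,
        abs_of_nonneg h0] at h
      exact h
  obtain ⟨g, hg⟩ := hU.homogeneous A (fun a ↦ F (κ a)) (hF.comp hκ)
  refine ⟨g.symm (F ρ), fun a ha ↦ ?_⟩
  rw [← g.dist_eq, g.apply_symm_apply, hg ⟨a, ha⟩, hF.dist_eq, hρ ⟨a, ha⟩]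

/-- The extension property for a finite family of points, possibly with repetitions. -/
theorem HasFiniteExtension.exists_forall_dist_eq {X ι : Type*} [MetricSpace X] {V : Set ℝ}
    (hX : HasFiniteExtension X V) (s : Finset ι) (a : ι → X) (r : ι → ℝ) (hr : ∀ i ∈ s, r i ∈ V)
    (hK : ∀ i ∈ s, ∀ j ∈ s, |r i - r j| ≤ dist (a i) (a j) ∧ dist (a i) (a j) ≤ r i + r j) :
    ∃ z, ∀ i ∈ s, dist z (a i) = r i := by
  classical
  have h : ∀ x, ∃ t : ℝ, ∀ i ∈ s, a i = x → r i = t := fun x ↦ by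
    by_cases hx : ∃ i ∈ s, a i = x
    · obtain ⟨j, hj, rfl⟩ := hx
      refine ⟨r j, fun i hi hij ↦ ?_⟩
      have := (hK i hi j hj).1
      rw [hij, dist_self] at this
      exact sub_eq_zero.1 (abs_nonpos_iff.1 this)
    · exact ⟨0, fun i hi hix ↦ absurd ⟨i, hi, hix⟩ hx⟩
  choose t ht using h
  obtain ⟨z, hz⟩ := hX (s.image a) t
    (by
      intro x hx
      obtain ⟨i, hi, rfl⟩ := Finset.mem_image.1 hx
      rw [← ht _ i hi rfl]
      exact hr i hi)
    (by
      intro x hx y hy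
      obtain ⟨i, hi, rfl⟩ := Finset.mem_image.1 hx
      obtain ⟨j, hj, rfl⟩ := Finset.mem_image.1 hy
      rw [← ht _ i hi rfl, ← ht _ j hj rfl]
      exact hK i hi j hj)
  exact ⟨z, fun i hi ↦ (hz _ (Finset.mem_image_of_mem a hi)).trans (ht _ i hi rfl).symm⟩

/-! ### Back and forth -/

/-- A finite partial isometry from `X` to `Y`, given by its graph. -/
def IsPartialIsometry {X Y : Type*} [MetricSpace X] [MetricSpace Y] (p : Finset (X × Y)) : Prop :=
  ∀ e ∈ p, ∀ e' ∈ p, dist e.1 e'.1 = dist e.2 e'.2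

theorem IsPartialIsometry.insert {X Y : Type*} [MetricSpace X] [MetricSpace Y] [DecidableEq (X × Y)]
    {p : Finset (X × Y)} (hp : IsPartialIsometry p) {x : X} {y : Y}
    (h : ∀ e ∈ p, dist x e.1 = dist y e.2) : IsPartialIsometry (insert (x, y) p) := by
  intro e he e' he'
  rcases Finset.mem_insert.1 he with rfl | he <;> rcases Finset.mem_insert.1 he' with rfl | he'
  · simp
  · exact h e' he'
  · rw [dist_comm, dist_comm e.2]
    exact h e he
  · exact hp e he e' he'

/-- A partial isometry extends to any further point of the domain whose distances are among those
that the target realises. -/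
theorem IsPartialIsometry.exists_forall_dist_eq {X Y : Type*} [MetricSpace X] [MetricSpace Y]
    {V : Set ℝ} (hY : HasFiniteExtension Y V) {p : Finset (X × Y)} (hp : IsPartialIsometry p)
    {x : X} (hx : ∀ e ∈ p, dist x e.1 ∈ V) : ∃ y, ∀ e ∈ p, dist x e.1 = dist y e.2 := by
  obtain ⟨y, hy⟩ := hY.exists_forall_dist_eq p Prod.snd (fun e ↦ dist x e.1) hx
    (fun e he e' he' ↦ by
      rw [← hp e he e' he']
      refine ⟨?_, dist_triangle_left _ _ _⟩
      rw [dist_comm x, dist_comm x]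
      exact abs_dist_sub_le _ _ _)
  exact ⟨y, fun e he ↦ (hy e he).symm⟩

/-- Back and forth: if finite partial isometries from the countable space `X` to `Y` extend to any
point of `X`, and can be extended so that their range meets any of the countably many sets `T k`,
then there is an isometry from `X` to `Y` whose range meets all the `T k`. -/
theorem exists_isometry_range_meets {X Y κ : Type*} [MetricSpace X] [MetricSpace Y] [Countable X]
    [Countable κ] (T : κ → Set Y)
    (forth : ∀ p : Finset (X × Y), IsPartialIsometry p → ∀ x, ∃ y, ∀ e ∈ p,
      dist x e.1 = dist y e.2)
    (back : ∀ p : Finset (X × Y), IsPartialIsometry p → ∀ k, ∃ x, ∃ y ∈ T k, ∀ e ∈ p,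
      dist x e.1 = dist y e.2) :
    ∃ φ : X → Y, Isometry φ ∧ ∀ k, ∃ x, φ x ∈ T k := by
  classical
  let P := {p : Finset (X × Y) // IsPartialIsometry p}
  let D : X ⊕ κ → Order.Cofinal P := Sum.elim
    (fun x ↦ ⟨{p | ∃ y, (x, y) ∈ p.1}, fun p ↦ by
      obtain ⟨y, hy⟩ := forth p.1 p.2 x
      exact ⟨⟨_, p.2.insert hy⟩, ⟨y, Finset.mem_insert_self _ _⟩, Finset.subset_insert _ _⟩⟩)
    (fun k ↦ ⟨{p | ∃ x, ∃ y ∈ T k, (x, y) ∈ p.1}, fun p ↦ by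
      obtain ⟨x, y, hk, hy⟩ := back p.1 p.2 k
      exact ⟨⟨_, p.2.insert hy⟩, ⟨x, y, hk, Finset.mem_insert_self _ _⟩,
        Finset.subset_insert _ _⟩⟩)
  have := Encodable.ofCountable (X ⊕ κ)
  let J := Order.idealOfCofinals (⟨∅, by intro e he; simp at he⟩ : P) D
  have hJ : ∀ p ∈ J, ∀ q ∈ J, ∀ e ∈ p.1, ∀ e' ∈ q.1, dist e.1 e'.1 = dist e.2 e'.2 := by
    intro p hp q hq e he e' he'
    obtain ⟨m, -, hpm, hqm⟩ := J.directed p hp q hq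
    exact m.2 e (hpm he) e' (hqm he')
  have hX : ∀ x, ∃ y, ∃ p ∈ J, (x, y) ∈ p.1 := fun x ↦ by
    obtain ⟨p, ⟨y, hy⟩, hp⟩ := Order.cofinal_meets_idealOfCofinals _ D (Sum.inl x)
    exact ⟨y, p, hp, hy⟩
  choose φ r hr hφ using hX
  refine ⟨φ, Isometry.of_dist_eq fun a b ↦ (hJ _ (hr a) _ (hr b) _ (hφ a) _ (hφ b)).symm,
    fun k ↦ ?_⟩
  obtain ⟨p, ⟨x, y, hy, hxy⟩, hp⟩ := Order.cofinal_meets_idealOfCofinals _ D (Sum.inr k)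
  refine ⟨x, ?_⟩
  have h := hJ _ (hr x) _ hp _ (hφ x) _ hxy
  simp only [dist_self] at h
  rwa [dist_eq_zero.1 h.symm]

/-- The rational Urysohn space is unique up to isometry. -/
theorem IsRationalUrysohn.nonempty_isometryEquiv {Q R : Type*} [MetricSpace Q] [MetricSpace R]
    (hQ : IsRationalUrysohn Q) (hR : IsRationalUrysohn R) : Nonempty (Q ≃ᵢ R) := by
  classical
  have := hQ.countable
  have := hR.countable
  obtain ⟨φ, hφ, hs⟩ := exists_isometry_range_meets (X := Q) (fun y : R ↦ {y})
    (fun p hp x ↦ hp.exists_forall_dist_eq hR.hasFiniteExtension fun e _ ↦ by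
      obtain ⟨q, hq⟩ := hQ.rational x e.1
      exact ⟨q, hq.symm⟩)
    (fun p hp y ↦ by
      have hp' : IsPartialIsometry (p.image Prod.swap) := by
        intro e he e' he'
        obtain ⟨d, hd, rfl⟩ := Finset.mem_image.1 he
        obtain ⟨d', hd', rfl⟩ := Finset.mem_image.1 he'
        exact (hp d hd d' hd').symm
      obtain ⟨x, hx⟩ := hp'.exists_forall_dist_eq hQ.hasFiniteExtension (x := y) fun e _ ↦ by
        obtain ⟨q, hq⟩ := hR.rational y e.1
        exact ⟨q, hq.symm⟩
      exact ⟨x, y, rfl, fun e he ↦ (hx _ (Finset.mem_image_of_mem _ he)).symm⟩)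
  exact ⟨⟨Equiv.ofBijective φ ⟨hφ.injective, hs⟩, hφ⟩⟩

/-! ### Rational grids -/

/-- The submonoid of `ℚ` of the nonnegative multiples of `1 / D`. -/
abbrev ratGrid (D : ℕ) : AddSubmonoid ℚ := AddSubmonoid.multiples (D : ℚ)⁻¹

theorem mem_ratGrid {D : ℕ} (hD : 0 < D) {x : ℚ} : x ∈ ratGrid D ↔ ∃ m : ℕ, D * x = m := by
  rw [AddSubmonoid.mem_multiples_iff]
  have : (D : ℚ) ≠ 0 := by positivity
  refine exists_congr fun m ↦ ?_
  rw [nsmul_eq_mul]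
  constructor
  · rintro rfl
    field_simp
  · intro h
    rw [← h]
    field_simp

theorem ratGrid_le_of_dvd {D E : ℕ} (hE : 0 < E) (h : D ∣ E) : ratGrid D ≤ ratGrid E := by
  intro x hx
  obtain ⟨c, rfl⟩ := h
  obtain ⟨m, hm⟩ := (mem_ratGrid (Nat.pos_of_mul_pos_right hE)).1 hx
  refine (mem_ratGrid hE).2 ⟨m * c, ?_⟩
  push_cast
  rw [← hm]
  ring

/-- Finitely many nonnegative rationals have a common denominator. -/
theorem exists_forall_mem_ratGrid {ι : Type*} (s : Finset ι) (r : ι → ℚ) (hr : ∀ i ∈ s, 0 ≤ r i) :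
    ∃ D : ℕ, 0 < D ∧ ∀ i ∈ s, r i ∈ ratGrid D := by
  refine ⟨∏ i ∈ s, (r i).den, Finset.prod_pos fun i _ ↦ (r i).den_pos, fun i hi ↦ ?_⟩
  refine ratGrid_le_of_dvd (Finset.prod_pos fun i _ ↦ (r i).den_pos)
    (Finset.dvd_prod_of_mem (fun i ↦ (r i).den) hi) ((mem_ratGrid (r i).den_pos).2
    ⟨(r i).num.toNat, ?_⟩)
  rw [Rat.den_mul_eq_num, ← Int.cast_natCast, Int.toNat_of_nonneg (Rat.num_nonneg.2 (hr i hi))]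

theorem exists_isLeast_of_subset_ratGrid {D : ℕ} (hD : 0 < D) {S : Set ℚ} (hS : S.Nonempty)
    (h : S ⊆ ratGrid D) : ∃ x, IsLeast S x := by
  classical
  have hex : ∃ m : ℕ, (m : ℚ) / D ∈ S := by
    obtain ⟨x, hx⟩ := hS
    obtain ⟨m, hm⟩ := (mem_ratGrid hD).1 (h hx)
    refine ⟨m, ?_⟩
    rwa [← hm, mul_div_cancel_left₀ _ (by positivity)]
  refine ⟨_, Nat.find_spec hex, fun x hx ↦ ?_⟩
  obtain ⟨m, hm⟩ := (mem_ratGrid hD).1 (h hx)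
  have hx' : (m : ℚ) / D = x := by
    rw [← hm, mul_div_cancel_left₀ _ (by positivity)]
  have := Nat.find_min' hex (by rwa [hx'] : (m : ℚ) / D ∈ S)
  rw [← hx']
  gcongr

/-! ### The rational Urysohn space is dense in the Urysohn space -/

/-- The range of a finite partial isometry from `Q` to `U` can be brought within `ε` of any point
`u`. The distances from `u` to the range are rounded up to multiples of `1 / D`, where `D > 1 / ε`
is a common denominator of the distances in the domain; this preserves the Katětov inequalities. The
rounded distances are realised in `Q`, and in `U` by a point at distance `1 / D` from `u`. -/
theorem exists_dist_lt_of_isPartialIsometry {Q U : Type*} [MetricSpace Q] [MetricSpace U]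
    (hQ : IsRationalUrysohn Q) (hU : HasFiniteExtension U Set.univ) {p : Finset (Q × U)}
    (hp : IsPartialIsometry p) (u : U) {ε : ℝ} (hε : 0 < ε) :
    ∃ x, ∃ y ∈ Metric.ball u ε, ∀ e ∈ p, dist x e.1 = dist y e.2 := by
  classical
  by_cases hu : ∃ e ∈ p, u = e.2
  · obtain ⟨e, he, rfl⟩ := hu
    exact ⟨e.1, e.2, Metric.mem_ball_self hε, hp e he⟩
  push Not at hu
  choose δ hδ using hQ.rational
  obtain ⟨D₀, hD₀, hgrid⟩ := exists_forall_mem_ratGrid (p ×ˢ p) (fun d ↦ δ d.1.1 d.2.1)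
    (fun d _ ↦ by exact_mod_cast (hδ d.1.1 d.2.1 ▸ dist_nonneg : (0 : ℝ) ≤ δ d.1.1 d.2.1))
  obtain ⟨N, hN⟩ := exists_nat_gt (1 / ε)
  have hN0 : 0 < N := by
    have : (0 : ℝ) < N := lt_trans (by positivity) hN
    exact_mod_cast this
  set D := D₀ * N with hDdef
  have hD : 0 < D := Nat.mul_pos hD₀ hN0
  have hDR : (0 : ℝ) < D := by exact_mod_cast hD
  have hDε : 1 / (D : ℝ) < ε := by
    have h1 : (N : ℝ) ≤ D := by exact_mod_cast Nat.le_mul_of_pos_left N hD₀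
    rw [div_lt_iff₀ hDR]
    rw [div_lt_iff₀ hε] at hN
    nlinarith
  have hint : ∀ e ∈ p, ∀ e' ∈ p, ∃ m : ℕ, D * dist e.2 e'.2 = m := by
    intro e he e' he'
    obtain ⟨m, hm⟩ := (mem_ratGrid hD).1 (ratGrid_le_of_dvd hD (Dvd.intro _ rfl)
      (hgrid (e, e') (Finset.mk_mem_product he he')))
    refine ⟨m, ?_⟩
    rw [← hp e he e' he', hδ]
    exact_mod_cast hm
  let c : Q × U → ℤ := fun e ↦ ⌈D * dist u e.2⌉
  let r : Q × U → ℝ := fun e ↦ c e / D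
  have hc : ∀ e, D * dist u e.2 ≤ c e := fun e ↦ Int.le_ceil _
  have hc' : ∀ e, (c e : ℝ) < D * dist u e.2 + 1 := fun e ↦ Int.ceil_lt_add_one _
  have hlip : ∀ e ∈ p, ∀ e' ∈ p, (c e : ℝ) ≤ c e' + D * dist e.2 e'.2 := by
    intro e he e' he'
    obtain ⟨m, hm⟩ := hint e he e' he'
    have : c e ≤ c e' + m := by
      refine Int.ceil_le.2 ?_
      push_cast
      have h1 := hc e'
      have h2 := dist_triangle_right u e.2 e'.2
      have h3 : D * dist u e.2 ≤ D * dist u e'.2 + D * dist e.2 e'.2 := by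
        rw [← mul_add]
        gcongr
      linarith
    rw [hm]
    exact_mod_cast this
  have hKr : ∀ e ∈ p, ∀ e' ∈ p,
      |r e - r e'| ≤ dist e.2 e'.2 ∧ dist e.2 e'.2 ≤ r e + r e' := by
    intro e he e' he'
    have h1 := hlip e he e' he'
    have h2 := hlip e' he' e he
    rw [dist_comm] at h2
    have h3 : D * dist e.2 e'.2 ≤ D * dist u e.2 + D * dist u e'.2 := by
      rw [← mul_add]
      gcongr
      exact dist_triangle_left _ _ _
    have h4 := hc e
    have h5 := hc e'
    refine ⟨?_, ?_⟩
    · rw [← sub_div, abs_div, abs_of_pos hDR, div_le_iff₀ hDR, abs_le]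
      constructor <;> linarith
    · rw [← add_div, le_div_iff₀ hDR]
      linarith
  have hru : ∀ e, dist u e.2 ≤ r e ∧ r e < dist u e.2 + 1 / D := by
    intro e
    have h4 := hc e
    have h5 := hc' e
    refine ⟨by rw [le_div_iff₀ hDR]; linarith, ?_⟩
    rw [div_lt_iff₀ hDR, add_mul, one_div, inv_mul_cancel₀ hDR.ne']
    linarith
  obtain ⟨x, hx⟩ := hQ.hasFiniteExtension.exists_forall_dist_eq p Prod.fst r
    (fun e _ ↦ ⟨c e / D, by push_cast; rfl⟩)
    (fun e he e' he' ↦ by rw [hp e he e' he']; exact hKr e he e' he')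
  -- the index `none` stands for the point `u`, from which the new point has distance `1 / D`
  obtain ⟨y, hy⟩ := hU.exists_forall_dist_eq (insert none (p.image some))
    (fun o : Option (Q × U) ↦ o.elim u Prod.snd) (fun o ↦ o.elim (1 / D) r) (fun _ _ ↦ trivial)
    (by
      have hpos : 0 ≤ 1 / (D : ℝ) := by positivity
      -- rounding up to a multiple of `1 / D` gives at least `1 / D`, since `u ≠ e.2`
      have hr1 : ∀ e ∈ p, 1 / (D : ℝ) ≤ r e := fun e he ↦ by
        have : (1 : ℤ) ≤ c e := Int.ceil_pos.2 (mul_pos hDR (dist_pos.2 (hu e he)))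
        have : (1 : ℝ) ≤ c e := by exact_mod_cast this
        simp only [r]
        gcongr
      have key : ∀ e ∈ p, |1 / (D : ℝ) - r e| ≤ dist u e.2 ∧ dist u e.2 ≤ 1 / D + r e :=
        fun e he ↦ by
          obtain ⟨h1, h2⟩ := hru e
          have h3 := hr1 e he
          refine ⟨abs_le.2 ⟨?_, ?_⟩, ?_⟩ <;> linarith [dist_nonneg (x := u) (y := e.2)]
      intro i hi j hj
      rcases i with _ | e <;> rcases j with _ | e' <;>
        simp only [Finset.mem_insert, Finset.mem_image, reduceCtorEq, and_false, exists_false,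
          Option.some.injEq, exists_eq_right, false_or] at hi hj <;>
        simp only [Option.elim]
      · simp
      · exact key e' hj
      · rw [abs_sub_comm, dist_comm, add_comm]
        exact key e hi
      · exact hKr e hi e' hj)
  refine ⟨x, y, ?_, fun e he ↦ ?_⟩
  · rw [Metric.mem_ball]
    exact (hy none (by simp)).trans_lt hDε
  · rw [hx e he]
    exact (hy (some e) (by simp [he])).symm

/-- The rational Urysohn space embeds isometrically in the Urysohn space as a dense subset. -/
theorem IsUrysohn.exists_isometry_denseRange {Q U : Type*} [MetricSpace Q] [MetricSpace U]
    (hQ : IsRationalUrysohn Q) (hU : IsUrysohn U) : ∃ ι : Q → U, Isometry ι ∧ DenseRange ι := by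
  have := hQ.countable
  have := hU.separable
  have hUe := hU.hasFiniteExtension
  have : Nonempty U := let ⟨z, _⟩ := hUe ∅ (fun _ ↦ 0) (by simp) (by simp); ⟨z⟩
  obtain ⟨φ, hφ, hs⟩ := exists_isometry_range_meets (X := Q)
    (fun k : ℕ × ℕ ↦ Metric.ball (TopologicalSpace.denseSeq U k.1) (1 / ((k.2 : ℝ) + 1)))
    (fun p hp x ↦ hp.exists_forall_dist_eq hUe fun _ _ ↦ trivial)
    (fun p hp k ↦ exists_dist_lt_of_isPartialIsometry hQ hUe hp _ (by positivity))
  refine ⟨φ, hφ, Metric.denseRange_iff.2 fun u ε hε ↦ ?_⟩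
  obtain ⟨n, hn⟩ := Metric.denseRange_iff.1 (TopologicalSpace.denseRange_denseSeq U) u (ε / 2)
    (by positivity)
  obtain ⟨m, hm⟩ := exists_nat_one_div_lt (half_pos hε)
  obtain ⟨x, hx⟩ := hs (n, m)
  refine ⟨x, (dist_triangle _ (TopologicalSpace.denseSeq U n) _).trans_lt ?_⟩
  rw [Metric.mem_ball, dist_comm] at hx
  linarith

/-! ### Extension of isometries from a dense subspace -/

/-- Isometries of `Q` extend to a complete space `U` in which `Q` is dense, and the extension is
a group homomorphism. -/
theorem exists_monoidHom_extending {Q U : Type*} [MetricSpace Q] [MetricSpace U] [CompleteSpace U]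
    {ι : Q → U} (hι : Isometry ι) (hd : DenseRange ι) :
    ∃ E : (Q ≃ᵢ Q) →* (U ≃ᵢ U), ∀ (g : Q ≃ᵢ Q) (x : Q), E g (ι x) = ι (g x) := by
  have hext : ∀ g : Q ≃ᵢ Q, ∃ F : U → U, Continuous F ∧ ∀ x, F (ι x) = ι (g x) := fun g ↦
    have hg : UniformContinuous (ι ∘ g) := (hι.comp g.isometry).uniformContinuous
    ⟨_, (uniformContinuous_uniformly_extend hι.isUniformInducing hd hg).continuous,
      uniformly_extend_of_ind hι.isUniformInducing hd hg⟩
  choose F hF hFι using hext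
  have hmul : ∀ g h, F (g * h) = F g ∘ F h := fun g h ↦
    hd.equalizer (hF _) ((hF g).comp (hF h)) <| funext fun x ↦ by simp [hFι]
  have hone : F 1 = id := hd.equalizer (hF _) continuous_id <| funext fun x ↦ by simp [hFι]
  have hiso : ∀ g, Isometry (F g) := fun g ↦ Isometry.of_dist_eq fun a b ↦ by
    refine hd.induction_on₂ (p := fun a b ↦ dist (F g a) (F g b) = dist a b)
      (isClosed_eq ?_ continuous_dist) (fun x y ↦ ?_) a b
    · exact ((hF g).comp continuous_fst).dist ((hF g).comp continuous_snd)
    · rw [hFι, hFι, hι.dist_eq, g.dist_eq, hι.dist_eq]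
  have hinv : ∀ g u, F g (F g⁻¹ u) = u := fun g u ↦ by
    rw [← Function.comp_apply (f := F g), ← hmul, mul_inv_cancel, hone, id]
  refine ⟨MonoidHom.mk' (fun g ↦ IsometryEquiv.mk' (F g) (F g⁻¹) (hinv g) (hiso g)) fun g h ↦ ?_,
    hFι⟩
  ext u
  exact congrFun (hmul g h) u

/-! ### Toeplitz functions -/

theorem IsometryEquiv.coe_toEquiv_zpow {X : Type*} [MetricSpace X] (g : X ≃ᵢ X) (n : ℤ) :
    ⇑(g.toEquiv ^ n) = ⇑(g ^ n) := by
  let φ : (X ≃ᵢ X) →* Equiv.Perm X := MonoidHom.mk' (fun g ↦ g.toEquiv) fun _ _ ↦ rfl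
  exact congrArg (fun e : Equiv.Perm X ↦ ⇑e) (map_zpow φ g n).symm

theorem isCyclicIsometry_iff {X : Type*} [MetricSpace X] {g : X ≃ᵢ X} :
    IsCyclicIsometry g ↔ ∀ x y : X, ∃ n : ℤ, (g ^ n) x = y := by
  simp only [IsCyclicIsometry, Equiv.Perm.IsCycleOn, Set.bijOn_univ, g.toEquiv.bijective,
    true_and, Set.mem_univ, forall_const, Equiv.Perm.SameCycle, IsometryEquiv.coe_toEquiv_zpow]

/-- A map that intertwines two isometries intertwines their powers. -/
theorem IsometryEquiv.map_zpow_apply {X Y : Type*} [MetricSpace X] [MetricSpace Y] {φ : X → Y}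
    {g : X ≃ᵢ X} {h : Y ≃ᵢ Y} (H : ∀ x, φ (g x) = h (φ x)) (n : ℤ) (x : X) :
    φ ((g ^ n) x) = (h ^ n) (φ x) := by
  induction n generalizing x with
  | zero => simp
  | succ n ih => rw [zpow_add_one, zpow_add_one, mul_apply, mul_apply, ih, H]
  | pred n ih =>
    rw [zpow_sub_one, zpow_sub_one, mul_apply, mul_apply, ih]
    refine congrArg _ (h.injective ?_)
    rw [← H, apply_inv_self, apply_inv_self]

theorem toeplitz_eq_of_isCyclicIsometry {X : Type*} [MetricSpace X] {g : X ≃ᵢ X}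
    (hg : IsCyclicIsometry g) (x y : X) : toeplitz g x = toeplitz g y := by
  obtain ⟨m, rfl⟩ := isCyclicIsometry_iff.1 hg x y
  ext n
  have h : (g ^ n) ((g ^ m) x) = (g ^ m) ((g ^ n) x) := by
    rw [← IsometryEquiv.mul_apply, ← IsometryEquiv.mul_apply,
      ((Commute.refl g).pow_left n).zpow_right m]
  rw [toeplitz, toeplitz, h, IsometryEquiv.dist_eq]

theorem dist_zpow_zpow {X : Type*} [MetricSpace X] (g : X ≃ᵢ X) (x : X) (m n : ℤ) :
    dist ((g ^ m) x) ((g ^ n) x) = toeplitz g x (m - n).natAbs := by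
  have h : ∀ (m : ℤ) (k : ℕ), dist ((g ^ m) x) ((g ^ (m + k)) x) = toeplitz g x k := fun m k ↦ by
    rw [zpow_add, IsometryEquiv.mul_apply, IsometryEquiv.dist_eq, zpow_natCast, toeplitz]
  rcases le_total m n with hmn | hmn
  · rw [← h m]
    congr
    omega
  · rw [dist_comm, ← h n]
    congr
    omega

/-- A conjugacy intertwines the Toeplitz functions. -/
theorem toeplitz_conj {X : Type*} [MetricSpace X] (c g : X ≃ᵢ X) (x : X) :
    toeplitz (c * g * c⁻¹) (c x) = toeplitz g x := by
  ext n
  rw [toeplitz, conj_pow, IsometryEquiv.mul_apply, IsometryEquiv.mul_apply,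
    IsometryEquiv.inv_apply_self, IsometryEquiv.dist_eq, toeplitz]

/-- Cyclic isometries with the same Toeplitz function are conjugate by the isometry
`gⁿ x ↦ hⁿ x`. -/
theorem isConj_of_toeplitz_eq {X : Type*} [MetricSpace X] {g h : X ≃ᵢ X}
    (hg : IsCyclicIsometry g) (hh : IsCyclicIsometry h) (x : X)
    (hgh : toeplitz g x = toeplitz h x) : IsConj g h := by
  have hdist : ∀ m n : ℤ, dist ((g ^ m) x) ((g ^ n) x) = dist ((h ^ m) x) ((h ^ n) x) :=
    fun m n ↦ by rw [dist_zpow_zpow, dist_zpow_zpow, hgh]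
  choose e he using isCyclicIsometry_iff.1 hg x
  let k : X → X := fun y ↦ (h ^ e y) x
  have hk : ∀ n : ℤ, k ((g ^ n) x) = (h ^ n) x := fun n ↦ by
    rw [← dist_eq_zero, ← hdist, he, dist_self]
  have hiso : Isometry k := Isometry.of_dist_eq fun y z ↦ by rw [← hdist, he, he]
  have hsurj : Function.Surjective k := fun z ↦ by
    obtain ⟨n, rfl⟩ := isCyclicIsometry_iff.1 hh x z
    exact ⟨_, hk n⟩
  let c : X ≃ᵢ X := ⟨Equiv.ofBijective k ⟨hiso.injective, hsurj⟩, hiso⟩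
  refine isConj_iff.2 ⟨c, mul_inv_eq_iff_eq_mul.2 ?_⟩
  ext y
  obtain ⟨n, rfl⟩ := isCyclicIsometry_iff.1 hg x y
  change k (g ((g ^ n) x)) = h (k ((g ^ n) x))
  rw [hk, ← IsometryEquiv.mul_apply, ← IsometryEquiv.mul_apply, ← zpow_one_add, ← zpow_one_add, hk]

theorem isConj_iff_toeplitz_eq {X : Type*} [MetricSpace X] [Nonempty X] {g h : X ≃ᵢ X}
    (hg : IsCyclicIsometry g) (hh : IsCyclicIsometry h) :
    IsConj g h ↔ ∀ x y : X, toeplitz g x = toeplitz h y := by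
  refine ⟨fun H x y ↦ ?_, fun H ↦ ?_⟩
  · obtain ⟨c, rfl⟩ := isConj_iff.1 H
    rw [← toeplitz_conj c g x]
    exact toeplitz_eq_of_isCyclicIsometry hh _ _
  · obtain ⟨x⟩ := ‹Nonempty X›
    exact isConj_of_toeplitz_eq hg hh x (H x x)

/-- If all orbits of `g` on a dense subset have the same Toeplitz function, so have all orbits. -/
theorem toeplitz_eq_of_denseRange {Q U : Type*} [MetricSpace Q] [MetricSpace U] {ι : Q → U}
    (hι : Isometry ι) (hd : DenseRange ι) {g : Q ≃ᵢ Q} {G : U ≃ᵢ U}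
    (hG : ∀ x, G (ι x) = ι (g x)) (hg : IsCyclicIsometry g) (x : Q) (u : U) :
    toeplitz G u = toeplitz g x := by
  ext n
  refine congrFun (hd.equalizer (g := fun v ↦ toeplitz G v n) (h := fun _ ↦ toeplitz g x n)
    (continuous_id.dist (G ^ n).continuous) continuous_const (funext fun y ↦ ?_)) u
  change dist (ι y) ((G ^ n) (ι y)) = toeplitz g x n
  rw [← zpow_natCast, ← IsometryEquiv.map_zpow_apply fun x ↦ (hG x).symm, hι.dist_eq, zpow_natCast]
  exact congrFun (toeplitz_eq_of_isCyclicIsometry hg y x) n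

/-! ### Rational norms on the integers -/

/-- A norm on the group `ℤ` with rational values. -/
structure IsRatNorm (f : ℤ → ℚ) : Prop where
  zero : f 0 = 0
  neg : ∀ n, f (-n) = f n
  add_le : ∀ m n, f (m + n) ≤ f m + f n
  pos : ∀ n, n ≠ 0 → 0 < f n

/-- A rational norm on `ℤ` that grows linearly and whose values have a common denominator. -/
structure IsTameNorm (f : ℤ → ℚ) : Prop extends IsRatNorm f where
  growth : ∃ c : ℚ, 0 < c ∧ ∀ n : ℤ, c * |(n : ℚ)| ≤ f n
  denom : ∃ D : ℕ, 0 < D ∧ ∀ n, f n ∈ ratGrid D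

theorem isTameNorm_abs : IsTameNorm fun n : ℤ ↦ |(n : ℚ)| where
  zero := by simp
  neg := by simp
  add_le m n := by push_cast; exact abs_add_le _ _
  pos n hn := abs_pos.2 (Int.cast_ne_zero.2 hn)
  growth := ⟨1, one_pos, fun n ↦ by simp⟩
  denom := ⟨1, one_pos, fun n ↦ (mem_ratGrid one_pos).2 ⟨n.natAbs, by simp⟩⟩

/-- The values prescribed by `g` on `A` are positive and satisfy the Katětov inequalities for the
translation-invariant metric given by `f`. -/
def IsKatetovOn (f : ℤ → ℚ) (A : Finset ℤ) (g : ℤ → ℚ) : Prop :=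
  (∀ a ∈ A, 0 < g a) ∧ ∀ a ∈ A, ∀ b ∈ A, |g a - g b| ≤ f (a - b) ∧ f (a - b) ≤ g a + g b

theorem exists_pos_forall_mul_le (A : Finset ℤ) {g : ℤ → ℚ} (hg : ∀ a ∈ A, 0 < g a) (h : ℤ → ℚ)
    {c₀ : ℚ} (hc₀ : 0 < c₀) (hh : ∀ a, 0 ≤ h a) : ∃ c, 0 < c ∧ c ≤ c₀ ∧ ∀ a ∈ A, c * h a ≤ g a := by
  classical
  induction A using Finset.induction_on with
  | empty => exact ⟨c₀, hc₀, le_rfl, by simp⟩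
  | insert a A _ ih =>
    obtain ⟨c, hc, hc', hA⟩ := ih fun b hb ↦ hg b (Finset.mem_insert_of_mem hb)
    have ha := hg a (Finset.mem_insert_self _ _)
    have h1 : 0 < h a + 1 := add_pos_of_nonneg_of_pos (hh a) one_pos
    refine ⟨min c (g a / (h a + 1)), lt_min hc (div_pos ha h1), (min_le_left _ _).trans hc',
      fun b hb ↦ ?_⟩
    rcases Finset.mem_insert.1 hb with rfl | hb
    · calc _ ≤ g b / (h b + 1) * h b := mul_le_mul_of_nonneg_right (min_le_right _ _) (hh b)
        _ ≤ g b / (h b + 1) * (h b + 1) := by gcongr; linarith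
        _ = g b := div_mul_cancel₀ _ h1.ne'
    · exact (mul_le_mul_of_nonneg_right (min_le_left _ _) (hh b)).trans (hA b hb)

theorem mul_abs_sum_le_sum {A : Finset ℤ} {g : ℤ → ℚ} {s : ℤ → ℤ} {c : ℚ} (hc : 0 ≤ c)
    (h : ∀ a ∈ A, c * |(s a : ℚ)| ≤ g a) :
    ∀ p : List ℤ, (∀ a ∈ p, a ∈ A) → c * |(((p.map s).sum : ℤ) : ℚ)| ≤ (p.map g).sum
  | [], _ => by simp
  | a :: p, hp => by
    have ih := mul_abs_sum_le_sum hc h p fun b hb ↦ hp b (List.mem_cons_of_mem _ hb)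
    have ha := h a (hp a List.mem_cons_self)
    simp only [List.map_cons, List.sum_cons]
    push_cast at ih ⊢
    have := mul_le_mul_of_nonneg_left (abs_add_le (s a : ℚ) (((p.map s).sum : ℤ) : ℚ)) hc
    push_cast at this
    linarith

theorem sum_map_sub (z : ℤ) (p : List ℤ) : (p.map (z - ·)).sum = p.length * z - p.sum := by
  induction p with
  | nil => simp
  | cons a p ih =>
    simp only [List.map_cons, List.sum_cons, ih, List.length_cons]
    push_cast
    ring

/-- Pairing the elements of two lists of the same length bounds the norm of the difference of
their sums. -/
theorem IsRatNorm.sum_sub_sum_le {f : ℤ → ℚ} (hf : IsRatNorm f) {A : Finset ℤ} {g : ℤ → ℚ}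
    (hg : IsKatetovOn f A g) : ∀ p q : List ℤ, (∀ a ∈ p, a ∈ A) → (∀ a ∈ q, a ∈ A) →
    p.length = q.length → f (p.sum - q.sum) ≤ (p.map g).sum + (q.map g).sum
  | [], [], _, _, _ => by simp [hf.zero]
  | a :: p, b :: q, hp, hq, h => by
    have ih := hf.sum_sub_sum_le hg p q (fun x hx ↦ hp x (List.mem_cons_of_mem _ hx))
      (fun x hx ↦ hq x (List.mem_cons_of_mem _ hx)) (by simpa using h)
    have hab := (hg.2 a (hp a List.mem_cons_self) b (hq b List.mem_cons_self)).2
    have := hf.add_le (a - b) (p.sum - q.sum)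
    simp only [List.map_cons, List.sum_cons]
    rw [show a + p.sum - (b + q.sum) = a - b + (p.sum - q.sum) by ring]
    linarith
  | [], _ :: _, _, _, h => by simp at h
  | _ :: _, [], _, _, h => by simp at h

/-! ### Prescribing the values of a norm on a distant block -/

/-- The cost of reaching `n` by steps `z - a` (for `a` in `p`) and `-(z - b)` (for `b` in `q`) of
costs `g a` and `g b`, together with one step measured by `f`. -/
def pathCost (f g : ℤ → ℚ) (z n : ℤ) (p q : List ℤ) : ℚ :=
  f (n - (p.map (z - ·)).sum + (q.map (z - ·)).sum) + (p.map g).sum + (q.map g).sum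

/-- The costs of all the ways of reaching `n` by steps `± (z - a)` with `a ∈ A`. -/
def pathCosts (f g : ℤ → ℚ) (A : Finset ℤ) (z n : ℤ) : Set ℚ :=
  {x | ∃ p q : List ℤ, (∀ a ∈ p, a ∈ A) ∧ (∀ a ∈ q, a ∈ A) ∧ pathCost f g z n p q = x}

/-- As `f` and `g` grow linearly, a path is at least as long as the distance from `n` to
`(p.length - q.length) * z`. For large `z` it is thus expensive unless the numbers of steps forward
and backward balance. -/
theorem le_pathCost_of_growth {f g : ℤ → ℚ} {A : Finset ℤ} {c : ℚ} (hc : 0 ≤ c)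
    (hf : ∀ n : ℤ, c * |(n : ℚ)| ≤ f n) (hg : ∀ a ∈ A, c * |(a : ℚ)| ≤ g a) (z n : ℤ)
    {p q : List ℤ} (hp : ∀ a ∈ p, a ∈ A) (hq : ∀ a ∈ q, a ∈ A) :
    c * |(n - (p.length - q.length) * z : ℚ)| ≤ pathCost f g z n p q := by
  have h1 := mul_abs_sum_le_sum (s := id) hc hg p hp
  have h2 := mul_abs_sum_le_sum (s := id) hc hg q hq
  rw [List.map_id] at h1 h2
  have h3 := hf (n - (p.map (z - ·)).sum + (q.map (z - ·)).sum)
  rw [pathCost]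
  refine le_trans ?_ (add_le_add (add_le_add h3 h1) h2)
  rw [← mul_add, ← mul_add]
  refine mul_le_mul_of_nonneg_left ?_ hc
  rw [sum_map_sub, sum_map_sub]
  push_cast
  refine le_trans (le_of_eq (congrArg _ ?_)) ((abs_add_le _ _).trans
    (add_le_add_left (abs_sub _ _) _))
  ring

theorem pathCost_eq_of_length_eq (f g : ℤ → ℚ) (z n : ℤ) {p q : List ℤ}
    (h : p.length = q.length) :
    pathCost f g z n p q = f (n + (p.sum - q.sum)) + (p.map g).sum + (q.map g).sum := by
  rw [pathCost, sum_map_sub, sum_map_sub, h]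
  congr 3
  ring

/-- A tame norm can be changed outside a bounded set so as to take the prescribed Katětov values
`g a` at the points `z - a`, for any sufficiently large `z`. The new norm at `n` is the least cost
of a path to `n`. -/
theorem IsTameNorm.exists_prescribed {f : ℤ → ℚ} (hf : IsTameNorm f) {A : Finset ℤ} {g : ℤ → ℚ}
    (hg : IsKatetovOn f A g) (N : ℕ) : ∃ z₀ : ℤ, ∀ z, z₀ ≤ z → ∃ f' : ℤ → ℚ, IsTameNorm f' ∧
      (∀ n : ℤ, n.natAbs ≤ N → f' n = f n) ∧ ∀ a ∈ A, f' (z - a) = g a := by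
  classical
  obtain ⟨c₀, hc₀, hfc₀⟩ := hf.growth
  obtain ⟨c, hc, hcc₀, hgc⟩ := exists_pos_forall_mul_le A hg.1 (fun a ↦ |(a : ℚ)|) hc₀
    fun _ ↦ abs_nonneg _
  have hfc : ∀ n : ℤ, c * |(n : ℚ)| ≤ f n := fun n ↦
    (mul_le_mul_of_nonneg_right hcc₀ (abs_nonneg _)).trans (hfc₀ n)
  -- `M` bounds the integers, and `B` the values, that have to be preserved or prescribed
  obtain ⟨M, hM⟩ := (insert N (A.image Int.natAbs)).exists_le
  obtain ⟨B, hB⟩ := ((Finset.Icc (-N : ℤ) N).image f ∪ A.image g).exists_le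
  have hBf : ∀ n : ℤ, n.natAbs ≤ N → f n ≤ B := fun n hn ↦
    hB _ (Finset.mem_union_left _ (Finset.mem_image_of_mem _ (Finset.mem_Icc.2 (by omega))))
  have hBg : ∀ a ∈ A, g a ≤ B := fun a ha ↦
    hB _ (Finset.mem_union_right _ (Finset.mem_image_of_mem _ ha))
  have hMN : N ≤ M := hM _ (Finset.mem_insert_self _ _)
  have hMA : ∀ a ∈ A, a.natAbs ≤ M := fun a ha ↦
    hM _ (Finset.mem_insert_of_mem (Finset.mem_image_of_mem _ ha))
  refine ⟨max (⌈B / c⌉ + M) 0, fun z hz ↦ ?_⟩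
  have hzB : B ≤ c * ((z : ℚ) - M) := by
    have h1 := Int.le_ceil (B / c)
    have h2 : ((⌈B / c⌉ + M : ℤ) : ℚ) ≤ z := by exact_mod_cast (le_max_left _ _).trans hz
    push_cast at h2
    rw [div_le_iff₀ hc] at h1
    nlinarith
  have hz0 : (0 : ℚ) ≤ z := by exact_mod_cast (le_max_right _ _).trans hz
  have hfar : ∀ (n k : ℤ), n.natAbs ≤ M → k ≠ 0 → B ≤ c * |(n - k * z : ℚ)| := by
    intro n k hn hk
    refine hzB.trans (mul_le_mul_of_nonneg_left ?_ hc.le)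
    have h1 : (1 : ℚ) ≤ |(k : ℚ)| := by exact_mod_cast Int.one_le_abs hk
    have h2 : |(n : ℚ)| ≤ M := by
      have : |n| ≤ (M : ℤ) := by rw [Int.abs_eq_natAbs]; exact_mod_cast hn
      exact_mod_cast this
    have h3 : |(k : ℚ) * z| - |(n : ℚ)| ≤ |(n - k * z : ℚ)| := by
      rw [abs_sub_comm]
      exact abs_sub_abs_le_abs_sub _ _
    rw [abs_mul, abs_of_nonneg hz0] at h3
    nlinarith
  obtain ⟨D₀, hD₀, hfD⟩ := hf.denom
  obtain ⟨E, hE, hgE⟩ := exists_forall_mem_ratGrid A g fun a ha ↦ (hg.1 a ha).le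
  have hD : 0 < D₀ * E := Nat.mul_pos hD₀ hE
  have hgD : ∀ p : List ℤ, (∀ a ∈ p, a ∈ A) → (p.map g).sum ∈ ratGrid (D₀ * E) := fun p hp ↦
    list_sum_mem fun x hx ↦ by
      obtain ⟨a, ha, rfl⟩ := List.mem_map.1 hx
      exact ratGrid_le_of_dvd hD (Dvd.intro_left _ rfl) (hgE a (hp a ha))
  have hsub : ∀ n, pathCosts f g A z n ⊆ ratGrid (D₀ * E) := by
    rintro n x ⟨p, q, hp, hq, rfl⟩
    exact add_mem (add_mem (ratGrid_le_of_dvd hD (Dvd.intro _ rfl) (hfD _)) (hgD p hp)) (hgD q hq)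
  have hleast : ∀ n, ∃ x, IsLeast (pathCosts f g A z n) x := fun n ↦
    exists_isLeast_of_subset_ratGrid hD ⟨_, [], [], by simp, by simp, rfl⟩ (hsub n)
  choose f' hf' using hleast
  have hle : ∀ n p q, (∀ a ∈ p, a ∈ A) → (∀ a ∈ q, a ∈ A) → f' n ≤ pathCost f g z n p q :=
    fun n p q hp hq ↦ (hf' n).2 ⟨p, q, hp, hq, rfl⟩
  have heq : ∀ n : ℤ, n.natAbs ≤ N → f' n = f n := by
    intro n hn
    refine le_antisymm (by simpa [pathCost] using hle n [] [] (by simp) (by simp)) ?_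
    obtain ⟨p, q, hp, hq, hpq⟩ := (hf' n).1
    rw [← hpq]
    by_cases hl : p.length = q.length
    · -- opposite steps are paired, and each pair costs at least as much as its `f`-length
      rw [pathCost_eq_of_length_eq f g z n hl]
      have h1 := hf.sum_sub_sum_le hg p q hp hq hl
      have h2 := hf.add_le (n + (p.sum - q.sum)) (-(p.sum - q.sum))
      rw [hf.neg, add_neg_cancel_right] at h2
      linarith
    · refine (hBf n hn).trans (le_trans ?_ (le_pathCost_of_growth hc.le hfc hgc z n hp hq))
      have := hfar n (p.length - q.length) (hn.trans hMN) (by omega)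
      push_cast at this
      exact this
  -- the growth constant of the new norm depends on `z`, as a step by `z - a` costs only `g a`
  obtain ⟨c', hc', hcc', hgc'⟩ := exists_pos_forall_mul_le A hg.1 (fun a ↦ |((z - a : ℤ) : ℚ)|) hc
    fun _ ↦ abs_nonneg _
  have hgrowth : ∀ n : ℤ, c' * |(n : ℚ)| ≤ f' n := by
    intro n
    obtain ⟨p, q, hp, hq, hpq⟩ := (hf' n).1
    have h1 := mul_abs_sum_le_sum (s := (z - ·)) hc'.le hgc' p hp
    have h2 := mul_abs_sum_le_sum (s := (z - ·)) hc'.le hgc' q hq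
    have h3 := hfc (n - (p.map (z - ·)).sum + (q.map (z - ·)).sum)
    have h4 := mul_le_mul_of_nonneg_right hcc'
      (abs_nonneg ((n - (p.map (z - ·)).sum + (q.map (z - ·)).sum : ℤ) : ℚ))
    rw [← hpq, pathCost]
    refine le_trans ?_ (add_le_add (add_le_add (h4.trans h3) h1) h2)
    rw [← mul_add, ← mul_add]
    refine mul_le_mul_of_nonneg_left ?_ hc'.le
    push_cast
    refine le_trans (le_of_eq (congrArg _ ?_)) ((abs_sub _ _).trans
      (add_le_add_left (abs_add_le _ _) _))
    ring
  have hneg : ∀ n, f' (-n) ≤ f' n := by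
    intro n
    obtain ⟨p, q, hp, hq, hpq⟩ := (hf' n).1
    refine (hle (-n) q p hq hp).trans (le_of_eq ?_)
    rw [← hpq, pathCost, pathCost, ← hf.neg, add_right_comm]
    congr 3
    ring
  refine ⟨f', ⟨⟨(heq 0 (by simp)).trans hf.zero, fun n ↦ le_antisymm (hneg n) ?_, fun m n ↦ ?_,
    fun n hn ↦ ?_⟩, ⟨c', hc', hgrowth⟩, ⟨D₀ * E, hD, fun n ↦ hsub n (hf' n).1⟩⟩, heq,
    fun a ha ↦ le_antisymm ?_ ?_⟩
  · simpa using hneg (-n)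
  · obtain ⟨p, q, hp, hq, hpq⟩ := (hf' m).1
    obtain ⟨p', q', hp', hq', hpq'⟩ := (hf' n).1
    refine (hle (m + n) (p ++ p') (q ++ q') ?_ ?_).trans ?_
    · intro a ha
      exact (List.mem_append.1 ha).elim (hp a) (hp' a)
    · intro a ha
      exact (List.mem_append.1 ha).elim (hq a) (hq' a)
    · rw [← hpq, ← hpq']
      simp only [pathCost, List.map_append, List.sum_append]
      have h := hf.add_le (m - (p.map (z - ·)).sum + (q.map (z - ·)).sum)
        (n - (p'.map (z - ·)).sum + (q'.map (z - ·)).sum)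
      rw [show m + n - ((p.map (z - ·)).sum + (p'.map (z - ·)).sum) +
        ((q.map (z - ·)).sum + (q'.map (z - ·)).sum) =
        m - (p.map (z - ·)).sum + (q.map (z - ·)).sum +
        (n - (p'.map (z - ·)).sum + (q'.map (z - ·)).sum) by ring]
      linarith
  · exact (mul_pos hc' (abs_pos.2 (Int.cast_ne_zero.2 hn))).trans_le (hgrowth n)
  · simpa [pathCost, hf.zero] using hle (z - a) [a] [] (by simpa using ha) (by simp)
  · obtain ⟨p, q, hp, hq, hpq⟩ := (hf' (z - a)).1
    rw [← hpq]
    by_cases hl : p.length = q.length + 1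
    · -- one step `z - b` remains unpaired, and `g a ≤ g b + f (a - b)`
      obtain ⟨b, p, rfl⟩ := List.exists_cons_of_length_eq_add_one hl
      have hb := hp b List.mem_cons_self
      have h1 := hf.sum_sub_sum_le hg p q (fun x hx ↦ hp x (List.mem_cons_of_mem _ hx)) hq
        (by simpa using hl)
      have h2 := hf.add_le (b - a + (p.sum - q.sum)) (-(p.sum - q.sum))
      rw [hf.neg, add_neg_cancel_right] at h2
      have h3 := (abs_le.1 (hg.2 b hb a ha).1).1
      have h4 : pathCost f g z (z - a) (b :: p) q =
          f (b - a + (p.sum - q.sum)) + (g b + (p.map g).sum) + (q.map g).sum := by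
        rw [pathCost, sum_map_sub, sum_map_sub, hl]
        simp only [List.sum_cons, List.map_cons]
        congr 3
        push_cast
        ring
      rw [h4]
      linarith
    · refine (hBg a ha).trans (le_trans ?_ (le_pathCost_of_growth hc.le hfc hgc z _ hp hq))
      have := hfar (-a) (p.length - q.length - 1) (by simpa using hMA a ha) (by omega)
      refine this.trans (le_of_eq (congrArg (c * |·|) ?_))
      push_cast
      ring

/-! ### A binary tree of norms -/

/-- A finite approximation to a norm on `ℤ`: the values of the tame norm `toFun` at integers of
absolute value at most `bound` are final. -/
structure NormApprox where
  toFun : ℤ → ℚ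
  tame : IsTameNorm toFun
  bound : ℕ

namespace NormApprox

instance : Preorder NormApprox where
  le c d := c.bound ≤ d.bound ∧ ∀ n : ℤ, n.natAbs ≤ c.bound → d.toFun n = c.toFun n
  le_refl c := ⟨le_rfl, fun _ _ ↦ rfl⟩
  le_trans _ _ _ h h' :=
    ⟨h.1.trans h'.1, fun n hn ↦ (h'.2 n (hn.trans h.1)).trans (h.2 n hn)⟩

instance : Inhabited NormApprox := ⟨⟨_, isTameNorm_abs, 0⟩⟩

theorem exists_bound_ge (c : NormApprox) (N : ℕ) : ∃ d, c ≤ d ∧ N ≤ d.bound ∧ d.toFun = c.toFun :=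
  ⟨⟨c.toFun, c.tame, max c.bound N⟩, ⟨le_max_left _ _, fun _ _ ↦ rfl⟩, le_max_right _ _, rfl⟩

/-- The request `g` has been dealt with: the final values decide whether `g` is a Katětov function
on its support, and if it is, then they contain a point that realises it. -/
def Decides (c : NormApprox) (g : ℤ →₀ ℚ) : Prop :=
  (∀ a ∈ g.support, ∀ b ∈ g.support, (a - b).natAbs ≤ c.bound) ∧
    (IsKatetovOn c.toFun g.support g →
      ∃ z : ℤ, ∀ a ∈ g.support, (z - a).natAbs ≤ c.bound ∧ c.toFun (z - a) = g a)

theorem exists_decides (c : NormApprox) (g : ℤ →₀ ℚ) : ∃ d, c ≤ d ∧ d.Decides g := by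
  classical
  obtain ⟨N, hN⟩ := ((g.support ×ˢ g.support).image fun x ↦ (x.1 - x.2).natAbs).exists_le
  obtain ⟨d, hcd, hNd, -⟩ := c.exists_bound_ge N
  have hd : ∀ a ∈ g.support, ∀ b ∈ g.support, (a - b).natAbs ≤ d.bound := fun a ha b hb ↦
    (hN _ (Finset.mem_image_of_mem _ (Finset.mk_mem_product ha hb))).trans hNd
  by_cases hg : IsKatetovOn d.toFun g.support g
  · obtain ⟨z, hz⟩ := d.tame.exists_prescribed hg d.bound
    obtain ⟨f, hf, hfd, hfz⟩ := hz z le_rfl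
    obtain ⟨M, hM⟩ := (g.support.image fun a ↦ (z - a).natAbs).exists_le
    refine ⟨⟨f, hf, max d.bound M⟩, hcd.trans ⟨le_max_left _ _, hfd⟩,
      fun a ha b hb ↦ (hd a ha b hb).trans (le_max_left _ _), fun _ ↦ ⟨z, fun a ha ↦
      ⟨(hM _ (Finset.mem_image_of_mem _ ha)).trans (le_max_right _ _), hfz a ha⟩⟩⟩
  · exact ⟨d, hcd, hd, fun h ↦ absurd h hg⟩

/-- Any approximation has two incompatible extensions: a distant integer can be given the norm
`1` or the norm `2`. -/
theorem exists_split (c : NormApprox) : ∃ d : Bool → NormApprox, (∀ b, c ≤ d b) ∧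
    ∃ n : ℤ, (∀ b, n.natAbs ≤ (d b).bound) ∧ (d true).toFun n ≠ (d false).toFun n := by
  have hK : ∀ q : ℚ, 0 < q → IsKatetovOn c.toFun {0} fun _ ↦ q := fun q hq ↦ by
    refine ⟨fun _ _ ↦ hq, fun a ha b hb ↦ ?_⟩
    rw [Finset.mem_singleton.1 ha, Finset.mem_singleton.1 hb, sub_zero, c.tame.zero]
    simp only [sub_self, abs_zero, le_refl, true_and]
    linarith
  obtain ⟨z₁, h₁⟩ := c.tame.exists_prescribed (hK 1 one_pos) c.bound
  obtain ⟨z₂, h₂⟩ := c.tame.exists_prescribed (hK 2 two_pos) c.bound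
  obtain ⟨f₁, hf₁, hc₁, hz₁⟩ := h₁ (max z₁ z₂) (le_max_left _ _)
  obtain ⟨f₂, hf₂, hc₂, hz₂⟩ := h₂ (max z₁ z₂) (le_max_right _ _)
  let N := max c.bound (max z₁ z₂).natAbs
  refine ⟨fun b ↦ cond b ⟨f₁, hf₁, N⟩ ⟨f₂, hf₂, N⟩, ?_, max z₁ z₂, ?_, ?_⟩
  · rintro (_ | _)
    exacts [⟨le_max_left _ _, hc₂⟩, ⟨le_max_left _ _, hc₁⟩]
  · rintro (_ | _) <;> exact le_max_right _ _
  · have e₁ := hz₁ 0 (Finset.mem_singleton_self _)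
    have e₂ := hz₂ 0 (Finset.mem_singleton_self _)
    rw [sub_zero] at e₁ e₂
    simp only [cond_true, cond_false, e₁, e₂]
    norm_num

/-- Two incompatible extensions that deal with a given request. -/
theorem exists_step (c : NormApprox) (g : ℤ →₀ ℚ) (k : ℕ) : ∃ d : Bool → NormApprox,
    (∀ b, c ≤ d b ∧ k ≤ (d b).bound ∧ (d b).Decides g) ∧
    ∃ n : ℤ, (∀ b, n.natAbs ≤ (d b).bound) ∧ (d true).toFun n ≠ (d false).toFun n := by
  obtain ⟨d, hd, n, hn, hne⟩ := c.exists_split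
  have h : ∀ b, ∃ e, d b ≤ e ∧ k ≤ e.bound ∧ e.Decides g := fun b ↦ by
    obtain ⟨d', h', hk, -⟩ := (d b).exists_bound_ge k
    obtain ⟨e, he, hg⟩ := d'.exists_decides g
    exact ⟨e, h'.trans he, hk.trans he.1, hg⟩
  choose e hde hk hg using h
  refine ⟨e, fun b ↦ ⟨(hd b).trans (hde b), hk b, hg b⟩, n, fun b ↦ (hn b).trans (hde b).1, ?_⟩
  rwa [(hde true).2 n (hn true), (hde false).2 n (hn false)]

/-- An increasing sequence of approximations with unbounded `bound` has a limit. -/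
theorem exists_limit {c : ℕ → NormApprox} (hc : Monotone c) (hb : ∀ N, ∃ k, N ≤ (c k).bound) :
    ∃ f : ℤ → ℚ, IsRatNorm f ∧
      ∀ k (n : ℤ), n.natAbs ≤ (c k).bound → f n = (c k).toFun n := by
  choose k hk using hb
  have h : ∀ j (n : ℤ), n.natAbs ≤ (c j).bound →
      (c (k n.natAbs)).toFun n = (c j).toFun n := fun j n hn ↦ by
    rcases le_total j (k n.natAbs) with h | h
    · exact (hc h).2 n hn
    · exact ((hc h).2 n (hk _)).symm
  refine ⟨fun n ↦ (c (k n.natAbs)).toFun n, ⟨(c _).tame.zero, fun n ↦ ?_, fun m n ↦ ?_,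
    fun n hn ↦ (c _).tame.pos n hn⟩, h⟩
  · simp only [Int.natAbs_neg, (c _).tame.neg]
  · let N := m.natAbs + n.natAbs
    have hN := hk N
    rw [h (k N) m (by omega), h (k N) n (by omega), h (k N) (m + n) (by omega)]
    exact (c _).tame.add_le m n

end NormApprox

/-- A rational norm on `ℤ` whose translation-invariant metric has the extension property of the
rational Urysohn space, for positive Katětov functions. -/
structure IsUrysohnNorm (f : ℤ → ℚ) : Prop extends IsRatNorm f where
  extension : ∀ (A : Finset ℤ) (g : ℤ → ℚ), IsKatetovOn f A g → ∃ z, ∀ a ∈ A, f (z - a) = g a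

open NormApprox in
/-- Branches of a binary tree of approximations, all of which deal with all requests, give
continuum many Urysohn norms. -/
theorem exists_injective_isUrysohnNorm :
    ∃ F : (ℕ → Bool) → ℤ → ℚ, Function.Injective F ∧ ∀ X, IsUrysohnNorm (F X) := by
  classical
  obtain ⟨req, hreq⟩ := exists_surjective_nat (ℤ →₀ ℚ)
  choose next hnext m hm hne using fun (k : ℕ) (c : NormApprox) ↦ c.exists_step (req k) k
  let c : (ℕ → Bool) → ℕ → NormApprox := fun X k ↦
    Nat.rec default (fun k d ↦ next k d (X k)) k
  have hc : ∀ X k, c X (k + 1) = next k (c X k) (X k) := fun _ _ ↦ rfl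
  have hmono : ∀ X, Monotone (c X) := fun X ↦
    monotone_nat_of_le_succ fun k ↦ (hnext k (c X k) (X k)).1
  choose F hF hlim using fun X ↦ exists_limit (hmono X) fun N ↦
    ⟨N + 1, (hnext N (c X N) (X N)).2.1⟩
  refine ⟨F, fun X Y hXY ↦ ?_, fun X ↦ ⟨hF X, fun A g hg ↦ ?_⟩⟩
  · have key : ∀ k, c X k = c Y k → X k = Y k := fun k hk ↦ by
      by_contra hXk
      -- at the first branching the two final values at `m k (c X k)` differ
      have h1 := hlim X (k + 1) (m k (c X k)) (hm k _ _)
      have h2 := hlim Y (k + 1) (m k (c X k)) (by rw [hc, ← hk]; exact hm k _ _)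
      rw [hc] at h1 h2
      rw [hXY, h2, ← hk] at h1
      have := hne k (c X k)
      cases hx : X k <;> cases hy : Y k <;> rw [hx, hy] at h1 <;> simp_all
    have hcc : ∀ k, c X k = c Y k := fun k ↦ by
      induction k with
      | zero => rfl
      | succ k ih => rw [hc, hc, ih, key k ih]
    exact funext fun k ↦ key k (hcc k)
  · obtain ⟨k, hk⟩ := hreq (Finsupp.indicator A fun a _ ↦ g a)
    have hval : ∀ a ∈ A, req k a = g a := fun a ha ↦ by
      rw [hk, Finsupp.indicator_of_mem ha]
    have hsupp : (req k).support = A := by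
      refine Finset.Subset.antisymm (hk ▸ Finsupp.support_indicator_subset _ _) fun a ha ↦ ?_
      rw [Finsupp.mem_support_iff, hval a ha]
      exact (hg.1 a ha).ne'
    obtain ⟨h1, h2⟩ := (hnext k (c X k) (X k)).2.2
    rw [← hc, hsupp] at h1 h2
    obtain ⟨z, hz⟩ := h2 ⟨fun a ha ↦ (hval a ha).symm ▸ hg.1 a ha, fun a ha b hb ↦ by
      rw [hval a ha, hval b hb, ← hlim X (k + 1) _ (h1 a ha b hb)]
      exact hg.2 a ha b hb⟩
    refine ⟨z, fun a ha ↦ ?_⟩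
    rw [hlim X (k + 1) _ (hz a ha).1, (hz a ha).2, hval a ha]

/-! ### The integers as a rational Urysohn space -/

/-- The integers with the translation-invariant metric `f (m - n)` given by a norm `f`. This is a
structure, so as not to compete with the usual metric of `ℤ`. -/
@[ext]
structure NormedInt {f : ℤ → ℚ} (hf : IsRatNorm f) where
  val : ℤ

namespace NormedInt

variable {f : ℤ → ℚ}

theorem val_injective (hf : IsRatNorm f) : Function.Injective (val : NormedInt hf → ℤ) :=
  fun _ _ ↦ NormedInt.ext

instance (hf : IsRatNorm f) : Countable (NormedInt hf) := (val_injective hf).countable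

noncomputable instance (hf : IsRatNorm f) : MetricSpace (NormedInt hf) where
  dist m n := f (m.val - n.val)
  dist_self m := by rw [sub_self, hf.zero, Rat.cast_zero]
  dist_comm m n := by rw [← hf.neg, neg_sub]
  dist_triangle a b c := by
    have h := hf.add_le (a.val - b.val) (b.val - c.val)
    rw [sub_add_sub_cancel] at h
    exact_mod_cast h
  eq_of_dist_eq_zero {a b} h := by
    by_contra hab
    exact (hf.pos _ (sub_ne_zero.2 fun e ↦ hab (val_injective hf e))).ne' (by exact_mod_cast h)

theorem dist_def (hf : IsRatNorm f) (m n : NormedInt hf) : dist m n = f (m.val - n.val) := rfl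

/-- Translation by `1`. -/
def shift (hf : IsRatNorm f) : NormedInt hf ≃ᵢ NormedInt hf where
  toFun n := ⟨n.val + 1⟩
  invFun n := ⟨n.val - 1⟩
  left_inv n := by simp
  right_inv n := by simp
  isometry_toFun := Isometry.of_dist_eq fun a b ↦ by
    rw [dist_def, dist_def, add_sub_add_right_eq_sub]

theorem val_shift_zpow (hf : IsRatNorm f) (k : ℤ) (n : NormedInt hf) :
    ((shift hf ^ k) n).val = n.val + k := by
  induction k generalizing n with
  | zero => simp
  | succ k ih =>
    rw [zpow_add_one, IsometryEquiv.mul_apply, ih]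
    change n.val + 1 + _ = _
    ring
  | pred k ih =>
    rw [zpow_sub_one, IsometryEquiv.mul_apply, ih]
    change n.val - 1 + _ = _
    ring

theorem isCyclicIsometry_shift (hf : IsRatNorm f) : IsCyclicIsometry (shift hf) :=
  isCyclicIsometry_iff.2 fun x y ↦
    ⟨y.val - x.val, val_injective hf (by rw [val_shift_zpow, add_sub_cancel])⟩

theorem toeplitz_shift (hf : IsRatNorm f) (x : NormedInt hf) (n : ℕ) :
    toeplitz (shift hf) x n = f n := by
  rw [toeplitz, ← zpow_natCast, dist_def, val_shift_zpow, ← hf.neg, neg_sub, add_sub_cancel_left]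

theorem isRationalUrysohn (hf : IsUrysohnNorm f) :
    IsRationalUrysohn (NormedInt hf.toIsRatNorm) where
  countable := inferInstance
  rational x y := ⟨_, dist_def _ x y⟩
  extension A g h0 hK := by
    classical
    by_cases h : ∃ a ∈ A, g a = 0
    · -- if `g` vanishes at `a`, then the Katětov inequalities force `g = dist a`
      obtain ⟨a, ha, hga⟩ := h
      refine ⟨a, fun b hb ↦ ?_⟩
      obtain ⟨h1, h2⟩ := hK a ha b hb
      rw [hga, Rat.cast_zero, zero_sub, abs_neg] at h1
      rw [hga, Rat.cast_zero, zero_add] at h2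
      exact le_antisymm h2 ((le_abs_self _).trans h1)
    · obtain ⟨z, hz⟩ := hf.extension (A.image val) (fun n ↦ g ⟨n⟩) (by
        constructor
        · intro n hn
          obtain ⟨a, ha, rfl⟩ := Finset.mem_image.1 hn
          exact lt_of_le_of_ne (h0 a ha) fun e ↦ h ⟨a, ha, e.symm⟩
        · intro m hm n hn
          obtain ⟨a, ha, rfl⟩ := Finset.mem_image.1 hm
          obtain ⟨b, hb, rfl⟩ := Finset.mem_image.1 hn
          obtain ⟨h1, h2⟩ := hK a ha b hb
          rw [dist_def] at h1 h2
          exact ⟨by exact_mod_cast h1, by exact_mod_cast h2⟩)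
      exact ⟨⟨z⟩, fun a ha ↦ congrArg ((↑) : ℚ → ℝ) (hz _ (Finset.mem_image_of_mem _ ha))⟩

end NormedInt

/-! ### Counting conjugacy classes -/

/-- Every Urysohn norm is the Toeplitz function of a cyclic isometry, namely of the translation by
`1`, transported to `Q` by the uniqueness of the rational Urysohn space. -/
theorem IsUrysohnNorm.exists_isCyclicIsometry {Q : Type*} [MetricSpace Q]
    (hQ : IsRationalUrysohn Q) {f : ℤ → ℚ} (hf : IsUrysohnNorm f) :
    ∃ g : Q ≃ᵢ Q, IsCyclicIsometry g ∧ ∀ x (n : ℕ), toeplitz g x n = f n := by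
  obtain ⟨e⟩ := hQ.nonempty_isometryEquiv (NormedInt.isRationalUrysohn hf)
  let s := NormedInt.shift hf.toIsRatNorm
  let g : Q ≃ᵢ Q := (e.trans s).trans e.symm
  have hg : ∀ (n : ℤ) x, e ((g ^ n) x) = (s ^ n) (e x) :=
    IsometryEquiv.map_zpow_apply fun x ↦ e.apply_symm_apply _
  refine ⟨g, isCyclicIsometry_iff.2 fun x y ↦ ?_, fun x n ↦ ?_⟩
  · obtain ⟨n, hn⟩ := isCyclicIsometry_iff.1 (NormedInt.isCyclicIsometry_shift _) (e x) (e y)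
    exact ⟨n, e.injective (by rw [hg, hn])⟩
  · rw [← NormedInt.toeplitz_shift hf.toIsRatNorm (e x), toeplitz, toeplitz, ← zpow_natCast,
      ← zpow_natCast, ← hg, e.dist_eq]

theorem mk_cyclicClasses {Q : Type*} [MetricSpace Q] (hQ : IsRationalUrysohn Q) :
    Cardinal.mk (cyclicClasses Q) = Cardinal.continuum := by
  obtain ⟨x₀, -⟩ := hQ.extension ∅ (fun _ ↦ 0) (by simp) (by simp)
  have : Nonempty Q := ⟨x₀⟩
  apply le_antisymm
  · choose g hg hgc using fun c : cyclicClasses Q ↦ c.2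
    have hinj : Function.Injective fun c ↦ toeplitz (g c) x₀ := fun c d hcd ↦ Subtype.ext <| by
      rw [← hgc c, ← hgc d]
      exact ConjClasses.mk_eq_mk_iff_isConj.2 (isConj_of_toeplitz_eq (hg c) (hg d) x₀ hcd)
    have h := Cardinal.lift_mk_le_lift_mk_of_injective hinj
    simpa [Cardinal.mk_real] using h
  · obtain ⟨F, hF, hU⟩ := exists_injective_isUrysohnNorm
    choose g hg hgF using fun X ↦ (hU X).exists_isCyclicIsometry hQ
    have hinj : Function.Injective
        fun X ↦ (⟨ConjClasses.mk (g X), g X, hg X, rfl⟩ : cyclicClasses Q) := fun X Y hXY ↦ by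
      have h := (isConj_iff_toeplitz_eq (hg X) (hg Y)).1
        (ConjClasses.mk_eq_mk_iff_isConj.1 (congrArg Subtype.val hXY)) x₀ x₀
      have hnat : ∀ n : ℕ, F X n = F Y n := fun n ↦ by
        have h' := congrFun h n
        rw [hgF, hgF] at h'
        exact_mod_cast h'
      refine hF (funext fun n ↦ ?_)
      obtain ⟨t, rfl | rfl⟩ := n.eq_nat_or_neg
      · exact hnat t
      · rw [(hU X).neg, (hU Y).neg, hnat t]
    have h := Cardinal.lift_mk_le_lift_mk_of_injective hinj
    simpa using h

/-! ### Cyclic isometries of the rational Urysohn space -/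

theorem corollary12 {Q : Type u} [MetricSpace Q] (hQ : IsRationalUrysohn Q) :
    -- there are exactly continuum many conjugacy classes of cyclic isometries in `Aut(Q)`
    Cardinal.mk (cyclicClasses Q) = Cardinal.continuum ∧
    -- the Toeplitz function of a cyclic isometry does not depend on the base point
    (∀ g : Q ≃ᵢ Q, IsCyclicIsometry g → ∀ x y : Q, toeplitz g x = toeplitz g y) ∧
    -- the Toeplitz function is a complete invariant of these classes
    (∀ g h : Q ≃ᵢ Q, IsCyclicIsometry g → IsCyclicIsometry h →
      (IsConj g h ↔ ∀ x y : Q, toeplitz g x = toeplitz h y)) ∧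
    -- the Urysohn space is a completion of `Q`, isometries of `Q` extend to it, and
    -- non-conjugate cyclic isometries of `Q` have non-conjugate extensions
    (∀ (U : Type v) [MetricSpace U], IsUrysohn U →
      (∃ ι : Q → U, Isometry ι ∧ DenseRange ι) ∧
      ∀ ι : Q → U, Isometry ι → DenseRange ι →
        ∃ E : (Q ≃ᵢ Q) →* (U ≃ᵢ U), Function.Injective E ∧
          (∀ (g : Q ≃ᵢ Q) (x : Q), E g (ι x) = ι (g x)) ∧
          ∀ g h : Q ≃ᵢ Q, IsCyclicIsometry g → IsCyclicIsometry h →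
            ¬ IsConj g h → ¬ IsConj (E g) (E h)) := by
  have : Nonempty Q := let ⟨z, _⟩ := hQ.extension ∅ (fun _ ↦ 0) (by simp) (by simp); ⟨z⟩
  refine ⟨mk_cyclicClasses hQ, fun g hg ↦ toeplitz_eq_of_isCyclicIsometry hg,
    fun g h ↦ isConj_iff_toeplitz_eq, fun U _ hU ↦ ⟨hU.exists_isometry_denseRange hQ,
    fun ι hι hd ↦ ?_⟩⟩
  have := hU.complete
  obtain ⟨E, hE⟩ := exists_monoidHom_extending hι hd
  refine ⟨E, fun g h hgh ↦ ?_, hE, fun g h hg hh hgh hconj ↦ hgh ?_⟩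
  · ext x
    apply hι.injective
    rw [← hE, ← hE, hgh]
  · -- the extensions have the Toeplitz functions of `g` and `h`, which a conjugacy preserves
    refine (isConj_iff_toeplitz_eq hg hh).2 fun x y ↦ ?_
    obtain ⟨c, hc⟩ := isConj_iff.1 hconj
    rw [← toeplitz_eq_of_denseRange hι hd (hE g) hg x (ι x), ← toeplitz_conj c, hc,
      toeplitz_eq_of_denseRange hι hd (hE h) hh y]
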